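/- **Theorem.** Let $M$ be a complex manifold of complex dimension $n$, with holomorphic tangent bundle $T^{1,0}M$ and slit bundle $\tilde M=T^{1,0}M\setminus\{0\}$. Let $F:T^{1,0}M\to[0,+\infty)$ be a strongly convex complex Finsler metric, that is: $F$ is positive and $C^\infty$ on $\tilde M$; $F(z;\lambda v)=|\lambda|F(z;v)$ for all $\lambda\in\mathbb C$; and, in the real coordinates $z^\alpha=x^\alpha+ix^{\alpha^*}$, $v^\alpha=y^\alpha+iy^{\alpha^*}$ ($\alpha^*=\alpha+n$) induced by any holomorphic chart, the matrix $g_{jk}=\frac12\frac{\partial^2F^2}{\partial y^j\partial y^k}$ is positive definite on $\tilde M$. Greek indices run over $1,\dots,n$, Roman ones over $1,\dots,2n$, repeated indices are summed, and $(g^{jk})$ is the inverse of $(g_{jk})$. *Cartan connection.* Put $\hat{\mathbb G}^k=\frac14g^{kl}\big(\frac{\partial^2F^2}{\partial x^a\partial y^l}y^a-\frac{\partial F^2}{\partial x^l}\big)$, $\hat\Gamma^k_j=\frac{\partial\hat{\mathbb G}^k}{\partial y^j}$, $\frac{\delta}{\delta x^j}=\frac{\partial}{\partial x^j}-\hat\Gamma^k_j\frac{\partial}{\partial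 y^k}$, $\delta y^l=dy^l+\hat\Gamma^l_mdx^m$, $$\hat\Gamma^k_{j;l}=\tfrac12g^{ks}\Big(\frac{\delta g_{sj}}{\delta x^l}-\frac{\delta g_{jl}}{\delta x^s}+\frac{\delta g_{ls}}{\delta x^j}\Big),\qquad \hat\Gamma^k_{jl}=\tfrac14g^{ks}\frac{\partial^3F^2}{\partial y^j\partial y^l\partial y^s}.$$ The Cartan connection $\nabla$ is the connection on the real vertical bundle $\mathcal V_{\mathbb R}=\operatorname{span}\{\partial/\partial y^k\}$ over $\tilde M$ with $\nabla\frac{\partial}{\partial y^j}=(\hat\Gamma^k_{j;l}dx^l+\hat\Gamma^k_{jl}\delta y^l)\otimes\frac{\partial}{\partial y^k}$. *Chern–Finsler connection.* Put $G_{\alpha\bar\beta}=\frac{\partial^2F^2}{\partial v^\alpha\partial\bar v^\beta}$, with inverse $G^{\bar\tau\alpha}$ ($G_{\beta\bar\tau}G^{\bar\tau\alpha}=\delta^\alpha_\beta$), $\Gamma^\alpha_{;\mu}=G^{\bar\tau\alpha}\frac{\partial^2F^2}{\partial z^\mu\partial\bar v^\tau}$, $\delta_\mu=\frac{\partial}{\partial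 z^\mu}-\Gamma^\alpha_{;\mu}\frac{\partial}{\partial v^\alpha}$, $\psi^\gamma=dv^\gamma+\Gamma^\gamma_{;\mu}dz^\mu$, $$\Gamma^\alpha_{\beta;\mu}=G^{\bar\tau\alpha}\delta_\mu(G_{\beta\bar\tau}),\qquad\Gamma^\alpha_{\beta\gamma}=G^{\bar\tau\alpha}\frac{\partial G_{\beta\bar\tau}}{\partial v^\gamma}.$$ The Chern–Finsler connection $D$ is the connection on the holomorphic vertical bundle $\mathcal V^{1,0}=\operatorname{span}\{\partial/\partial v^\alpha\}$ over $\tilde M$ with $D\frac{\partial}{\partial v^\beta}=(\Gamma^\alpha_{\beta;\mu}dz^\mu+\Gamma^\alpha_{\beta\gamma}\psi^\gamma)\otimes\frac{\partial}{\partial v^\alpha}$. Let $\mathbf J$ be the canonical complex structure of the complex manifold $T^{1,0}M$; on vertical vectors $\mathbf J\frac{\partial}{\partial y^\alpha}=\frac{\partial}{\partial y^{\alpha^*}}$, $\mathbf J\frac{\partial}{\partial y^{\alpha^*}}=-\frac{\partial}{\partial y^\alpha}$. Write $\nabla\mathbf J=0$ if $\nabla_X(\mathbf JY)=\mathbf J(\nabla_XY)$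 for all $X\in T_{\mathbb R}\tilde M$ (horizontal and vertical) and all smooth sections $Y$ of $\mathcal V_{\mathbb R}$. Extend $\nabla$ complex-bilinearly to $T_{\mathbb C}\tilde M$ and $\mathcal V_{\mathbb C}=\mathcal V_{\mathbb R}\otimes\mathbb C\supset\mathcal V^{1,0}$, where $\frac{\partial}{\partial v^\alpha}=\frac12\big(\frac{\partial}{\partial y^\alpha}-i\frac{\partial}{\partial y^{\alpha^*}}\big)$. Then $\nabla\mathbf J=0$ if and only if the complexified Cartan connection coincides with the Chern–Finsler connection, i.e. $\nabla_ZV=D_ZV$ for all $Z\in T_{\mathbb C}\tilde M$ and all smooth sections $V$ of $\mathcal V^{1,0}$. In that case, in every holomorphic chart and for all $\alpha,\beta,\gamma$, $$\mathcal N^\beta_{\alpha;\gamma}:=\hat\Gamma^\beta_{\alpha;\gamma}+i\hat\Gamma^{\beta^*}_{\alpha;\gamma}=\Gamma^\beta_{\alpha;\gamma},\qquad \mathcal N^\beta_{\alpha\gamma}:=\hat\Gamma^\beta_{\alpha\gamma}+i\hat\Gamma^{\beta^*}_{\alpha\gamma}=\Gamma^\beta_{\alpha\gamma}.$$ -/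

import Mathlib

open scoped Manifold ContDiff Topology

noncomputable section

namespace ComplexFinsler

/-- The model space `ℂⁿ` of an `n`-dimensional complex manifold. -/
abbrev Cn (n : ℕ) : Type := Fin n → ℂ

/-- Real indices `1, …, 2n`: `Sum.inl α` is the index `α`, `Sum.inr α` is `α* = α + n`. -/
abbrev RIdx (n : ℕ) : Type := Fin n ⊕ Fin n

variable {n : ℕ}

/-! ### Coordinates

A point `p = (z, v) : Cn n × Cn n` carries the holomorphic coordinates `(z; v)` of the holomorphic
tangent bundle over a chart domain, and the real coordinates `(x; y)` given by
`z^α = x^α + i x^{α*}`, `v^α = y^α + i y^{α*}`. -/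

/-- The coordinate vector of index `j`: `∂/∂x^α` points along `1`, `∂/∂x^{α*}` along `i`. -/
def realBasis : RIdx n → Cn n :=
  Sum.elim (fun α => Pi.single α 1) (fun α => Pi.single α Complex.I)

/-- Real coordinates of a vector of `ℂⁿ`. -/
def realCoord (w : Cn n) : RIdx n → ℝ :=
  Sum.elim (fun α => (w α).re) (fun α => (w α).im)

section PartialDerivatives

variable {A : Type*} [NormedAddCommGroup A] [NormedSpace ℝ A]

/-- `∂f/∂x^j`. -/
def dX (j : RIdx n) (f : Cn n × Cn n → A) (p : Cn n × Cn n) : A :=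
  fderiv ℝ f p (realBasis j, 0)

/-- `∂f/∂y^j`. -/
def dY (j : RIdx n) (f : Cn n × Cn n → A) (p : Cn n × Cn n) : A :=
  fderiv ℝ f p (0, realBasis j)

end PartialDerivatives

/-- `∂f/∂z^α = ½ (∂/∂x^α - i ∂/∂x^{α*}) f`. -/
def dZ (α : Fin n) (f : Cn n × Cn n → ℂ) (p : Cn n × Cn n) : ℂ :=
  1 / 2 * (dX (Sum.inl α) f p - Complex.I * dX (Sum.inr α) f p)

/-- `∂f/∂v^α = ½ (∂/∂y^α - i ∂/∂y^{α*}) f`. -/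
def dV (α : Fin n) (f : Cn n × Cn n → ℂ) (p : Cn n × Cn n) : ℂ :=
  1 / 2 * (dY (Sum.inl α) f p - Complex.I * dY (Sum.inr α) f p)

/-- `∂f/∂v̄^α = ½ (∂/∂y^α + i ∂/∂y^{α*}) f`. -/
def dVbar (α : Fin n) (f : Cn n × Cn n → ℂ) (p : Cn n × Cn n) : ℂ :=
  1 / 2 * (dY (Sum.inl α) f p + Complex.I * dY (Sum.inr α) f p)

/-! ### The Cartan connection in coordinates

Below, `L : Cn n × Cn n → ℝ` is the coordinate expression of `F²`. -/

/-- The real fundamental tensor `g_{jk} = ½ ∂²F²/∂y^j∂y^k`. -/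
def fundTensor (L : Cn n × Cn n → ℝ) (p : Cn n × Cn n) : Matrix (RIdx n) (RIdx n) ℝ :=
  Matrix.of fun j k => 1 / 2 * dY j (dY k L) p

/-- The geodesic spray coefficients
`Ĝ^k = ¼ g^{kl} (∂²F²/∂x^a∂y^l y^a - ∂F²/∂x^l)`. -/
def spray (L : Cn n × Cn n → ℝ) (k : RIdx n) (p : Cn n × Cn n) : ℝ :=
  1 / 4 * ∑ l, (fundTensor L p)⁻¹ k l *
    ((∑ a, dX a (dY l L) p * realCoord p.2 a) - dX l L p)

/-- The real non-linear connection coefficients `Γ̂^k_j = ∂Ĝ^k/∂y^j`. -/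
def realNonlinear (L : Cn n × Cn n → ℝ) (k j : RIdx n) (p : Cn n × Cn n) : ℝ :=
  dY j (spray L k) p

/-- `δf/δx^j = ∂f/∂x^j - Γ̂^k_j ∂f/∂y^k`. -/
def deltaX (L : Cn n × Cn n → ℝ) (j : RIdx n) (f : Cn n × Cn n → ℝ) (p : Cn n × Cn n) : ℝ :=
  dX j f p - ∑ k, realNonlinear L k j p * dY k f p

/-- The horizontal Cartan coefficients `Γ̂^k_{j;l}`,
`Γ̂^k_{j;l} = ½ g^{ks} (δg_{sj}/δx^l - δg_{jl}/δx^s + δg_{ls}/δx^j)`. -/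
def cartanH (L : Cn n × Cn n → ℝ) (k j l : RIdx n) (p : Cn n × Cn n) : ℝ :=
  ∑ s, (fundTensor L p)⁻¹ k s / 2 *
    (deltaX L l (fun q => fundTensor L q s j) p - deltaX L s (fun q => fundTensor L q j l) p
      + deltaX L j (fun q => fundTensor L q l s) p)

/-- The vertical Cartan coefficients `Γ̂^k_{jl} = ¼ g^{ks} ∂³F²/∂y^j∂y^l∂y^s`. -/
def cartanV (L : Cn n × Cn n → ℝ) (k j l : RIdx n) (p : Cn n × Cn n) : ℝ :=
  1 / 4 * ∑ s, (fundTensor L p)⁻¹ k s * dY j (dY l (dY s L)) p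

/-- The one-form `δy^l = dy^l + Γ̂^l_m dx^m`, evaluated on the real tangent vector `X` at `p`
(`X.1`, `X.2` are its `∂/∂x`- and `∂/∂y`-parts). -/
def deltaYForm (L : Cn n × Cn n → ℝ) (l : RIdx n) (p X : Cn n × Cn n) : ℝ :=
  realCoord X.2 l + ∑ m, realNonlinear L l m p * realCoord X.1 m

/-- The connection one-form `ω̂_j^k = Γ̂^k_{j;l} dx^l + Γ̂^k_{jl} δy^l`, evaluated on `X`. -/
def cartanForm (L : Cn n × Cn n → ℝ) (j k : RIdx n) (p X : Cn n × Cn n) : ℝ :=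
  ∑ l, (cartanH L k j l p * realCoord X.1 l + cartanV L k j l p * deltaYForm L l p X)

/-- The Cartan connection `∇_X Y` on real vertical fields `Y = Y^k ∂/∂y^k` in components:
`(∇_X Y)^k = X(Y^k) + Y^j ω̂_j^k(X)`. -/
def cartanCov (L : Cn n × Cn n → ℝ) (p X : Cn n × Cn n) (Y : Cn n × Cn n → RIdx n → ℝ) :
    RIdx n → ℝ :=
  fun k => fderiv ℝ (fun q => Y q k) p X + ∑ j, Y p j * cartanForm L j k p X

/-- The canonical complex structure of the holomorphic tangent bundle on real vertical vectors:
`𝐉 ∂/∂y^α = ∂/∂y^{α*}`, `𝐉 ∂/∂y^{α*} = -∂/∂y^α`, in components. -/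
def JVert (Y : RIdx n → ℝ) : RIdx n → ℝ :=
  Sum.elim (fun α => -Y (Sum.inr α)) (fun α => Y (Sum.inl α))

/-- The complex-bilinear extension of the Cartan connection, `∇_Z W` for the complex tangent vector
`Z = A + iB` at `p` (with `A`, `B` real) and a section `W = W^k ∂/∂y^k` of the complexified vertical
bundle (with complex components `W^k`). -/
def cartanCovC (L : Cn n × Cn n → ℝ) (p A B : Cn n × Cn n) (W : Cn n × Cn n → RIdx n → ℂ) :
    RIdx n → ℂ :=
  fun k =>
    ((cartanCov L p A (fun q j => (W q j).re) k - cartanCov L p B (fun q j => (W q j).im) k : ℝ) : ℂ)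
    + Complex.I *
    ((cartanCov L p A (fun q j => (W q j).im) k + cartanCov L p B (fun q j => (W q j).re) k : ℝ) : ℂ)

/-- The inclusion of the holomorphic vertical bundle in the complexified vertical bundle,
`V^α ∂/∂v^α = ½ V^α (∂/∂y^α - i ∂/∂y^{α*})`, in components. -/
def vertIncl (V : Cn n) : RIdx n → ℂ :=
  Sum.elim (fun α => 1 / 2 * V α) (fun α => -(1 / 2 * Complex.I * V α))

/-- `𝒩^β_{α;γ} = Γ̂^β_{α;γ} + i Γ̂^{β*}_{α;γ}`. -/
def complexCartanH (L : Cn n × Cn n → ℝ) (β α γ : Fin n) (p : Cn n × Cn n) : ℂ :=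
  cartanH L (Sum.inl β) (Sum.inl α) (Sum.inl γ) p
    + Complex.I * cartanH L (Sum.inr β) (Sum.inl α) (Sum.inl γ) p

/-- `𝒩^β_{αγ} = Γ̂^β_{αγ} + i Γ̂^{β*}_{αγ}`. -/
def complexCartanV (L : Cn n × Cn n → ℝ) (β α γ : Fin n) (p : Cn n × Cn n) : ℂ :=
  cartanV L (Sum.inl β) (Sum.inl α) (Sum.inl γ) p
    + Complex.I * cartanV L (Sum.inr β) (Sum.inl α) (Sum.inl γ) p

/-! ### The Chern–Finsler connection in coordinates -/

/-- The complex fundamental tensor `G_{αβ̄} = ∂²F²/∂v^α∂v̄^β`. The entry `(τ, α)` of the inverse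
matrix is `G^{τ̄α}`, for which `G_{βτ̄} G^{τ̄α} = δ_β^α`. -/
def levi (L : Cn n × Cn n → ℝ) (p : Cn n × Cn n) : Matrix (Fin n) (Fin n) ℂ :=
  Matrix.of fun α β => dV α (dVbar β (fun q => (L q : ℂ))) p

/-- The complex non-linear connection coefficients `Γ^α_{;μ} = G^{τ̄α} ∂²F²/∂z^μ∂v̄^τ`. -/
def chernNonlinear (L : Cn n × Cn n → ℝ) (α μ : Fin n) (p : Cn n × Cn n) : ℂ :=
  ∑ τ, (levi L p)⁻¹ τ α * dZ μ (dVbar τ (fun q => (L q : ℂ))) p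

/-- `δ_μ f = ∂f/∂z^μ - Γ^α_{;μ} ∂f/∂v^α`. -/
def deltaZ (L : Cn n × Cn n → ℝ) (μ : Fin n) (f : Cn n × Cn n → ℂ) (p : Cn n × Cn n) : ℂ :=
  dZ μ f p - ∑ α, chernNonlinear L α μ p * dV α f p

/-- The horizontal coefficients `Γ^α_{β;μ} = G^{τ̄α} δ_μ(G_{βτ̄})`. -/
def chernH (L : Cn n × Cn n → ℝ) (α β μ : Fin n) (p : Cn n × Cn n) : ℂ :=
  ∑ τ, (levi L p)⁻¹ τ α * deltaZ L μ (fun q => levi L q β τ) p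

/-- The vertical coefficients `Γ^α_{βγ} = G^{τ̄α} ∂G_{βτ̄}/∂v^γ`. -/
def chernV (L : Cn n × Cn n → ℝ) (α β γ : Fin n) (p : Cn n × Cn n) : ℂ :=
  ∑ τ, (levi L p)⁻¹ τ α * dV γ (fun q => levi L q β τ) p

/-- `dz^μ(A + iB)` for real tangent vectors `A`, `B`. -/
def dzForm (μ : Fin n) (A B : Cn n × Cn n) : ℂ := A.1 μ + Complex.I * B.1 μ

/-- `dv^γ(A + iB)` for real tangent vectors `A`, `B`. -/
def dvForm (γ : Fin n) (A B : Cn n × Cn n) : ℂ := A.2 γ + Complex.I * B.2 γ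

/-- `ψ^γ = dv^γ + Γ^γ_{;μ} dz^μ`, evaluated on `A + iB`. -/
def psiForm (L : Cn n × Cn n → ℝ) (γ : Fin n) (p A B : Cn n × Cn n) : ℂ :=
  dvForm γ A B + ∑ μ, chernNonlinear L γ μ p * dzForm μ A B

/-- The connection one-form `ω_β^α = Γ^α_{β;μ} dz^μ + Γ^α_{βγ} ψ^γ`, evaluated on `A + iB`. -/
def chernForm (L : Cn n × Cn n → ℝ) (β α : Fin n) (p A B : Cn n × Cn n) : ℂ :=
  ∑ μ, (chernH L α β μ p * dzForm μ A B + chernV L α β μ p * psiForm L μ p A B)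

/-- The Chern–Finsler connection `D_Z V` for the complex tangent vector `Z = A + iB` at `p` and a
section `V = V^α ∂/∂v^α` of the holomorphic vertical bundle, in components:
`(D_Z V)^α = Z(V^α) + V^β ω_β^α(Z)`. -/
def chernCov (L : Cn n × Cn n → ℝ) (p A B : Cn n × Cn n) (V : Cn n × Cn n → Cn n) : Cn n :=
  fun α => fderiv ℝ (fun q => V q α) p A + Complex.I * fderiv ℝ (fun q => V q α) p B
    + ∑ β, V p β * chernForm L β α p A B

/-! ### Finsler metrics on complex manifolds

For a complex manifold `M`, the tangent bundle `TangentBundle 𝓘(ℂ, Cn n) M` is the holomorphic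
tangent bundle; as a real bundle it is the real tangent bundle, with `J` the multiplication
by `i`. -/

section Manifold

variable {M : Type*} [TopologicalSpace M] [ChartedSpace (Cn n) M]

/-- The holomorphic charts of `M`. -/
def holCharts (n : ℕ) (M : Type*) [TopologicalSpace M] [ChartedSpace (Cn n) M] :
    Set (OpenPartialHomeomorph M (Cn n)) :=
  IsManifold.maximalAtlas 𝓘(ℂ, Cn n) ω M

/-- The slit tangent bundle over the domain of the chart `e`, in the induced coordinates. -/
def slit (e : OpenPartialHomeomorph M (Cn n)) : Set (Cn n × Cn n) :=
  {p | p.1 ∈ e.target ∧ p.2 ≠ 0}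

/-- The tangent vector `v^α ∂/∂z^α` at the point with coordinates `z` in the chart `e`. -/
def chartVector (e : OpenPartialHomeomorph M (Cn n)) (p : Cn n × Cn n) :
    TangentBundle 𝓘(ℂ, Cn n) M :=
  ⟨e.symm p.1, mfderiv 𝓘(ℂ, Cn n) 𝓘(ℂ, Cn n) e.symm p.1 p.2⟩

/-- The expression of `F²` in the coordinates `(z; v)` induced by the chart `e`. -/
def localSq (F : TangentBundle 𝓘(ℂ, Cn n) M → ℝ) (e : OpenPartialHomeomorph M (Cn n)) :
    Cn n × Cn n → ℝ :=
  fun p => F (chartVector e p) ^ 2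

/-- `F` is a strongly convex complex Finsler metric on `M`: it is positive and smooth off the zero
section, absolutely homogeneous with respect to complex scalars, and its real fundamental tensor is
positive definite off the zero section (so that the real metric it induces is a real strongly convex
Finsler metric). Non-negativity of `F` follows. -/
structure IsStronglyConvex (F : TangentBundle 𝓘(ℂ, Cn n) M → ℝ) : Prop where
  pos : ∀ (x : M) (v : TangentSpace 𝓘(ℂ, Cn n) x), v ≠ 0 → 0 < F ⟨x, v⟩
  smooth : ∀ e ∈ holCharts n M, ContDiffOn ℝ ∞ (fun p => F (chartVector e p)) (slit e)
  homogeneous : ∀ (x : M) (v : TangentSpace 𝓘(ℂ, Cn n) x) (c : ℂ), F ⟨x, c • v⟩ = ‖c‖ * F ⟨x, v⟩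
  posDef : ∀ e ∈ holCharts n M, ∀ p ∈ slit e, (fundTensor (localSq F e) p).PosDef

/-- `∇𝐉 = 0`: `∇_X (𝐉Y) = 𝐉 (∇_X Y)` for every real tangent vector `X` of the slit tangent bundle,
horizontal, vertical or otherwise, and every smooth real vertical vector field `Y`. -/
def CartanJParallel (F : TangentBundle 𝓘(ℂ, Cn n) M → ℝ) : Prop :=
  ∀ e ∈ holCharts n M, ∀ p ∈ slit e, ∀ (X : Cn n × Cn n) (Y : Cn n × Cn n → RIdx n → ℝ),
    ContDiffOn ℝ ∞ Y (slit e) →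
      cartanCov (localSq F e) p X (fun q => JVert (Y q))
        = JVert (cartanCov (localSq F e) p X Y)

/-- The complexified Cartan connection coincides with the Chern–Finsler connection: `∇_Z V = D_Z V`
for every complex tangent vector `Z = A + iB` of the slit tangent bundle and every smooth section `V`
of the holomorphic vertical bundle. -/
def CartanEqChernFinsler (F : TangentBundle 𝓘(ℂ, Cn n) M → ℝ) : Prop :=
  ∀ e ∈ holCharts n M, ∀ p ∈ slit e, ∀ (A B : Cn n × Cn n) (V : Cn n × Cn n → Cn n),
    ContDiffOn ℝ ∞ V (slit e) →
      cartanCovC (localSq F e) p A B (fun q => vertIncl (V q))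
        = vertIncl (chernCov (localSq F e) p A B V)

end Manifold

end ComplexFinsler

end

noncomputable section

namespace ComplexFinsler

variable {n : ℕ}

open scoped Matrix

/-! Since `𝐉` has constant components, `∇𝐉 = 0` says exactly that the matrix of the Cartan
connection form commutes with `J` in every direction.

In vertical directions this makes the Cartan tensor, with one index raised, complex linear. Total
symmetry and positive definiteness of `g` then force the tensor to vanish
(`symmetric_tensor_eq_zero`); no `J`-invariance of `g` is needed for this. Hence `g` is constant
along connected sets in the slit fibres, and invariance of `F²` under `v ↦ iv` makes `g`
`J`-invariant: the metric comes from a Hermitian metric on the base, with matrix `hermOf g = levi`.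
All vertical coefficients vanish, and the non-linear connections drop out because they only multiply
vertical derivatives of `g`. The horizontal Cartan coefficients become Christoffel symbols, and the
remaining claim is the Kähler fact that a Levi-Civita connection commuting with `J` is the Chern
connection (`sum_levi_civita_mul_hermOf`).

Conversely, the Chern–Finsler connection takes values in the holomorphic vertical bundle. A real
connection whose complexification preserves that bundle, the `i`-eigenspace of `𝐉`, commutes with
`𝐉` (`commute_cartanMatrix_of_eq_vertIncl`). -/

/-! ### Linear algebra of the complex structure and of symmetric tensors. -/

theorem JVert_eq_mulVec (Y : RIdx n → ℝ) : JVert Y = Matrix.J (Fin n) ℝ *ᵥ Y := by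
  ext (α | α) <;> simp [JVert, Matrix.J, Matrix.mulVec, dotProduct, Matrix.one_apply]

/-- A matrix commutes with the complex structure iff its blocks satisfy the Cauchy–Riemann
relations. -/
theorem commute_J_iff (A : Matrix (RIdx n) (RIdx n) ℝ) :
    Commute A (Matrix.J (Fin n) ℝ) ↔ ∀ α β, A (Sum.inr β) (Sum.inr α) = A (Sum.inl β) (Sum.inl α) ∧
      A (Sum.inl β) (Sum.inr α) = -A (Sum.inr β) (Sum.inl α) := by
  rw [commute_iff_eq, ← Matrix.fromBlocks_toBlocks A, Matrix.J, Matrix.fromBlocks_multiply,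
    Matrix.fromBlocks_multiply, Matrix.fromBlocks_inj]
  simp only [← Matrix.ext_iff, Matrix.add_apply, Matrix.mul_zero, Matrix.mul_one, Matrix.mul_neg,
    Matrix.zero_mul, Matrix.one_mul, Matrix.neg_mul, Matrix.zero_apply, Matrix.neg_apply,
    Matrix.fromBlocks_apply₁₁, Matrix.fromBlocks_apply₁₂, Matrix.fromBlocks_apply₂₁,
    Matrix.fromBlocks_apply₂₂]
  constructor
  · rintro ⟨h1, h2, h3, h4⟩ α β
    constructor
    · linarith [h2 β α]
    · linarith [h1 β α]
  · intro h
    refine ⟨fun i j => ?_, fun i j => ?_, fun i j => ?_, fun i j => ?_⟩ <;>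
      linarith [(h j i).1, (h j i).2]

/-- A totally symmetric tensor vanishes if, after raising one index with a positive definite metric,
it is complex linear. -/
theorem symmetric_tensor_eq_zero {g : Matrix (RIdx n) (RIdx n) ℝ} (hg : g.PosDef)
    {T : RIdx n → Matrix (RIdx n) (RIdx n) ℝ} (h₁ : ∀ l s j, T l s j = T l j s)
    (h₂ : ∀ l s j, T l s j = T s l j)
    (hJ : ∀ l, Commute (g⁻¹ * T l) (Matrix.J (Fin n) ℝ)) : ∀ l, T l = 0 := by
  intro l
  have hu : IsUnit g.det := (Matrix.isUnit_iff_isUnit_det _).1 hg.isUnit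
  set J := Matrix.J (Fin n) ℝ with hJdef
  obtain ⟨A, hA⟩ : ∃ A : RIdx n → Matrix (RIdx n) (RIdx n) ℝ, ∀ l, A l = g⁻¹ * T l := ⟨_, fun _ => rfl⟩
  simp only [← hA] at hJ
  have hT : ∀ l, T l = g * A l := fun l => by
    rw [hA, ← Matrix.mul_assoc, Matrix.mul_nonsing_inv _ hu, Matrix.one_mul]
  have hAs : ∀ l k j, A l k j = A j k l := fun l k j => by
    simp only [hA, Matrix.mul_apply]
    exact Finset.sum_congr rfl fun s _ => by rw [h₂ l, h₁ s, h₂ s]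
  -- `A_l J e_j = J A_l e_j = J A_j e_l = A_j J e_l`. Lowering the index again, `T_l J` is totally
  -- symmetric in its three indices.
  have hAJ : ∀ l k j, (A l * J) k j = (A j * J) k l := fun l k j => by
    rw [(hJ l).eq, (hJ j).eq, Matrix.mul_apply, Matrix.mul_apply]
    exact Finset.sum_congr rfl fun s _ => by rw [hAs l]
  have hTJ : ∀ l s j, (T l * J) s j = (T j * J) s l := fun l s j => by
    rw [hT l, hT j, Matrix.mul_assoc, Matrix.mul_assoc, Matrix.mul_apply, Matrix.mul_apply]
    exact Finset.sum_congr rfl fun k _ => by rw [hAJ l]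
  have hTJ' : ∀ l s j, (T l * J) s j = (T s * J) l j := fun l s j => by
    rw [Matrix.mul_apply, Matrix.mul_apply]
    exact Finset.sum_congr rfl fun k _ => by rw [h₂ l]
  have hsymm : (T l * J).transpose = T l * J := by
    ext s j
    rw [Matrix.transpose_apply, hTJ' l, hTJ j, hTJ' l]
  have hTt : (T l).transpose = T l := by ext s j; exact h₁ l j s
  -- As `Jᵀ = -J`, symmetry of `T_l` and of `T_l J` gives `T_l J = -J T_l`, while `A_l` commutes
  -- with `J`. So `g` anticommutes with `J` on the range of `A_l`.
  have hgA : g * J * A l = -(J * g * A l) := by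
    rw [Matrix.transpose_mul, hTt, hJdef, Matrix.J_transpose, ← hJdef, Matrix.neg_mul] at hsymm
    rw [Matrix.mul_assoc, ← (hJ l).eq, Matrix.mul_assoc J, ← hT, hsymm, hT, Matrix.mul_assoc]
  have hA0 : A l = 0 := by
    ext k j
    set B : RIdx n → ℝ := A l *ᵥ Pi.single j 1 with hB
    have e1 : g *ᵥ (J *ᵥ B) = -(J *ᵥ (g *ᵥ B)) := by
      rw [hB, Matrix.mulVec_mulVec, Matrix.mulVec_mulVec, Matrix.mulVec_mulVec,
        Matrix.mulVec_mulVec, ← Matrix.neg_mulVec, hgA]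
    -- `J` is orthogonal, so `g(JB, JB) = -g(B, B)`; positivity leaves only `B = 0`.
    have e2 : (J *ᵥ B) ⬝ᵥ (g *ᵥ (J *ᵥ B)) = -(B ⬝ᵥ (g *ᵥ B)) := by
      rw [e1, dotProduct_neg, Matrix.dotProduct_mulVec, ← Matrix.mulVec_transpose,
        Matrix.mulVec_mulVec, hJdef, Matrix.J_transpose, Matrix.neg_mul, Matrix.J_squared]
      simp
    have hB0 : B = 0 := by
      by_contra hne
      have p1 := hg.dotProduct_mulVec_pos hne
      have p2 := hg.posSemidef.dotProduct_mulVec_nonneg (J *ᵥ B)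
      simp only [star_trivial] at p1 p2
      linarith
    have := congrFun hB0 k
    rwa [hB, Matrix.mulVec_single_one] at this
  rw [hT, hA0, Matrix.mul_zero]

/-! ### Hermitian matrices of `J`-invariant metrics, and their Christoffel symbols. -/

/-- The Hermitian matrix attached to a `J`-invariant real symmetric matrix. -/
def hermOf (g : Matrix (RIdx n) (RIdx n) ℝ) : Matrix (Fin n) (Fin n) ℂ :=
  Matrix.of fun α τ => (g (Sum.inl α) (Sum.inl τ) : ℂ) + Complex.I * g (Sum.inl α) (Sum.inr τ)

/-- `J`-invariance of a bilinear form, in components. -/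
def JInvariant (g : Matrix (RIdx n) (RIdx n) ℝ) : Prop :=
  ∀ α β, g (Sum.inr α) (Sum.inr β) = g (Sum.inl α) (Sum.inl β) ∧
    g (Sum.inl α) (Sum.inr β) = -g (Sum.inr α) (Sum.inl β)

/-- Contraction of a complexified vector with `hermOf g`. -/
theorem sum_mul_hermOf {g : Matrix (RIdx n) (RIdx n) ℝ} (hJ : JInvariant g) (y : RIdx n → ℝ)
    (τ : Fin n) :
    ∑ β, ((y (Sum.inl β) : ℂ) + Complex.I * y (Sum.inr β)) * hermOf g β τ
      = ((∑ k, y k * g k (Sum.inl τ) : ℝ) : ℂ)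
        + Complex.I * ((∑ k, y k * g k (Sum.inr τ) : ℝ) : ℂ) := by
  simp only [Fintype.sum_sum_type, Complex.ofReal_add, Complex.ofReal_sum, Complex.ofReal_mul,
    ← Finset.sum_add_distrib, Finset.mul_sum, hermOf, Matrix.of_apply]
  refine Finset.sum_congr rfl fun β _ => ?_
  rw [(hJ β τ).1, (hJ β τ).2]
  push_cast
  linear_combination
    (-(y (Sum.inr β) : ℂ) * g (Sum.inr β) (Sum.inl τ)) * Complex.I_mul_I

/-- The real and imaginary parts of `ξ · hermOf g` are the components of `y · g`, where `y` holds
the real coordinates of `ξ`; a kernel vector of one gives a kernel vector of the other. -/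
theorem isUnit_det_hermOf {g : Matrix (RIdx n) (RIdx n) ℝ} (hJ : JInvariant g)
    (hu : IsUnit g.det) : IsUnit (hermOf g).det := by
  rw [isUnit_iff_ne_zero]
  intro h0
  obtain ⟨ξ, hξ, h⟩ := Matrix.exists_vecMul_eq_zero_iff.2 h0
  apply hξ
  set y : RIdx n → ℝ := realCoord ξ with hy
  have key : Matrix.vecMul y g = 0 := by
    have h2 : ∀ τ, ((∑ k, y k * g k (Sum.inl τ) : ℝ) : ℂ)
        + Complex.I * ((∑ k, y k * g k (Sum.inr τ) : ℝ) : ℂ) = 0 := fun τ => by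
      rw [← sum_mul_hermOf hJ]
      have := congrFun h τ
      simp only [Matrix.vecMul, dotProduct, Pi.zero_apply] at this
      rw [← this]
      refine Finset.sum_congr rfl fun β _ => ?_
      congr 1
      simp [hy, realCoord, mul_comm Complex.I, Complex.re_add_im]
    ext (τ | τ)
    · simpa [Matrix.vecMul, dotProduct] using congrArg Complex.re (h2 τ)
    · simpa [Matrix.vecMul, dotProduct] using congrArg Complex.im (h2 τ)
  have hy0 : y = 0 := by
    have := congrArg (fun w => Matrix.vecMul w g⁻¹) key
    simpa [Matrix.vecMul_vecMul, Matrix.mul_nonsing_inv _ hu] using this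
  ext β
  have a := congrFun hy0 (Sum.inl β)
  have b := congrFun hy0 (Sum.inr β)
  simp only [hy, realCoord, Sum.elim_inl, Sum.elim_inr, Pi.zero_apply] at a b
  exact Complex.ext a b

/-- For a `J`-invariant metric whose Levi-Civita symbols commute with `J`, the `(1,0)`-part of the
symbols contracted with the Hermitian metric is the `∂/∂z`-derivative of the Hermitian metric. -/
theorem sum_levi_civita_mul_hermOf {g : Matrix (RIdx n) (RIdx n) ℝ} (hg : ∀ j k, g j k = g k j)
    (hu : IsUnit g.det) (hJ : JInvariant g) {dg : RIdx n → Matrix (RIdx n) (RIdx n) ℝ}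
    (hdg : ∀ l j k, dg l j k = dg l k j) {Γ : RIdx n → RIdx n → RIdx n → ℝ}
    (hΓ : ∀ k j l, Γ k j l = ∑ s, g⁻¹ k s / 2 * (dg l s j - dg s j l + dg j l s))
    (hΓJ : ∀ l, Commute (Matrix.of fun k j => Γ k j l) (Matrix.J (Fin n) ℝ)) (α γ τ : Fin n) :
    ∑ β, ((Γ (Sum.inl β) (Sum.inl α) (Sum.inl γ) : ℂ)
        + Complex.I * Γ (Sum.inr β) (Sum.inl α) (Sum.inl γ)) * hermOf g β τ
      = 1 / 2 * (hermOf (dg (Sum.inl γ)) α τ - Complex.I * hermOf (dg (Sum.inr γ)) α τ) := by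
  -- Christoffel symbols of the first kind. They are symmetric in the last two slots, inherit
  -- `J`-invariance in the first two from `Γ` and `g`, and recover `dg` by metric compatibility.
  set C : RIdx n → RIdx n → RIdx n → ℝ :=
    fun s j l => 1 / 2 * (dg l s j - dg s j l + dg j l s) with hC
  have hlow : ∀ s j l, ∑ k, g s k * Γ k j l = C s j l := fun s j l => by
    have h1 : (fun k => Γ k j l) = g⁻¹ *ᵥ (fun s => C s j l) := by
      ext k
      rw [hΓ]
      exact Finset.sum_congr rfl fun s _ => by simp only [hC]; ring
    have h2 : g *ᵥ (fun k => Γ k j l) = fun s => C s j l := by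
      rw [h1, Matrix.mulVec_mulVec, Matrix.mul_nonsing_inv _ hu, Matrix.one_mulVec]
    exact congrFun h2 s
  have hCJ₁ : ∀ σ a l, C (Sum.inl σ) (Sum.inr a) l = -C (Sum.inr σ) (Sum.inl a) l := by
    intro σ a l
    have hc := (commute_J_iff _).1 (hΓJ l) a
    simp only [Matrix.of_apply] at hc
    rw [← hlow, ← hlow, Fintype.sum_sum_type, Fintype.sum_sum_type, ← Finset.sum_add_distrib,
      ← Finset.sum_add_distrib, ← Finset.sum_neg_distrib]
    refine Finset.sum_congr rfl fun b _ => ?_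
    rw [(hc b).1, (hc b).2, (hJ σ b).1, (hJ σ b).2]
    ring
  have hCJ₂ : ∀ σ a l, C (Sum.inr σ) (Sum.inr a) l = C (Sum.inl σ) (Sum.inl a) l := by
    intro σ a l
    have hc := (commute_J_iff _).1 (hΓJ l) a
    simp only [Matrix.of_apply] at hc
    rw [← hlow, ← hlow, Fintype.sum_sum_type, Fintype.sum_sum_type, ← Finset.sum_add_distrib,
      ← Finset.sum_add_distrib]
    refine Finset.sum_congr rfl fun b _ => ?_
    rw [(hc b).1, (hc b).2, (hJ σ b).1, (hJ σ b).2]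
    ring
  have hCs : ∀ s j l, C s j l = C s l j := fun s j l => by
    simp only [hC]; rw [hdg l s j, hdg s j l, hdg j l s]; ring
  have hCd : ∀ l s j, dg l s j = C s j l + C j s l := fun l s j => by
    simp only [hC]; rw [hdg s j l, hdg j s l, hdg l j s]; ring
  rw [sum_mul_hermOf hJ (fun k => Γ k (Sum.inl α) (Sum.inl γ))]
  have hl : ∀ s j l, ∑ k, Γ k j l * g k s = C s j l := fun s j l => by
    rw [← hlow]; exact Finset.sum_congr rfl fun k _ => by rw [hg k s, mul_comm]
  rw [hl, hl]
  simp only [hermOf, Matrix.of_apply, hCd]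
  -- These symmetries move every star from the last two slots to the first.
  rw [hCs (Sum.inr τ) (Sum.inl α) (Sum.inr γ), hCJ₂, hCJ₁ α τ (Sum.inr γ), hCs (Sum.inr α) _ (Sum.inr γ),
    hCJ₂, hCJ₁ α τ (Sum.inl γ), hCs (Sum.inl α) (Sum.inl τ) (Sum.inr γ), hCJ₁ α γ,
    hCs (Sum.inl τ) (Sum.inl α) (Sum.inr γ), hCJ₁ τ γ, hCs (Sum.inr τ) (Sum.inl γ),
    hCs (Sum.inl τ) (Sum.inl γ), hCs (Sum.inr α) (Sum.inl γ), hCs (Sum.inl α) (Sum.inl γ)]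
  push_cast
  linear_combination ((C (Sum.inl τ) (Sum.inl α) (Sum.inl γ) : ℂ) / 2
    - (C (Sum.inl α) (Sum.inl τ) (Sum.inl γ) : ℂ) / 2) * Complex.I_mul_I

/-! ### Real coordinates and differential calculus on open sets. -/

theorem realCoord_realBasis (j k : RIdx n) :
    realCoord (realBasis j) k = if k = j then 1 else 0 := by
  rcases j with j | j <;> rcases k with k | k <;>
    by_cases h : k = j <;> simp [realCoord, realBasis, Pi.single_apply, h]

theorem sum_realCoord_smul_realBasis (w : Cn n) : ∑ j, realCoord w j • realBasis j = w := by
  ext α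
  simp [Fintype.sum_sum_type, realCoord, realBasis, Pi.single_apply, Complex.re_add_im]

theorem I_smul_realBasis_inl (α : Fin n) :
    Complex.I • (realBasis (Sum.inl α) : Cn n) = realBasis (Sum.inr α) := by
  simp [realBasis, ← Pi.single_smul]

theorem I_smul_realBasis_inr (α : Fin n) :
    Complex.I • (realBasis (Sum.inr α) : Cn n) = -realBasis (Sum.inl α) := by
  simp [realBasis, ← Pi.single_smul, ← Pi.single_neg]

section Calculus

variable {E A : Type*} [NormedAddCommGroup E] [NormedSpace ℝ E] [NormedAddCommGroup A]
  [NormedSpace ℝ A] {U : Set E}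

theorem contDiffOn_fderiv_apply {f : E → A} (hU : IsOpen U) (hf : ContDiffOn ℝ ∞ f U) (w : E) :
    ContDiffOn ℝ ∞ (fun q => fderiv ℝ f q w) U :=
  (hf.fderiv_of_isOpen hU (by simp)).clm_apply contDiffOn_const

theorem differentiableAt_of_contDiffOn {f : E → A} (hU : IsOpen U) (hf : ContDiffOn ℝ ∞ f U)
    {p : E} (hp : p ∈ U) : DifferentiableAt ℝ f p :=
  (hf.contDiffAt (hU.mem_nhds hp)).differentiableAt (by simp)

theorem fderiv_fderiv_apply_comm {f : E → A} (hU : IsOpen U) (hf : ContDiffOn ℝ ∞ f U)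
    {p : E} (hp : p ∈ U) (v w : E) :
    fderiv ℝ (fun q => fderiv ℝ f q v) p w = fderiv ℝ (fun q => fderiv ℝ f q w) p v := by
  have hd : DifferentiableAt ℝ (fderiv ℝ f) p :=
    differentiableAt_of_contDiffOn hU (hf.fderiv_of_isOpen hU (by simp)) hp
  have hs := (hf.contDiffAt (hU.mem_nhds hp)).isSymmSndFDerivAt
    (by simpa using WithTop.coe_le_coe.2 (le_top : (2 : ℕ∞) ≤ ⊤))
  rw [fderiv_clm_apply hd (differentiableAt_const v), fderiv_clm_apply hd (differentiableAt_const w)]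
  simpa using hs.eq w v

theorem fderiv_apply_congr {f g : E → A} (hU : IsOpen U) (h : ∀ q ∈ U, f q = g q) {p : E}
    (hp : p ∈ U) : fderiv ℝ f p = fderiv ℝ g p :=
  Filter.EventuallyEq.fderiv_eq (Filter.eventuallyEq_of_mem (hU.mem_nhds hp) h)

/-- The derivative of a complex function given by its real and imaginary parts. -/
theorem fderiv_ofReal_add_I_mul {a b : E → ℝ} {p : E} (ha : DifferentiableAt ℝ a p)
    (hb : DifferentiableAt ℝ b p) (w : E) :
    fderiv ℝ (fun q => (a q : ℂ) + Complex.I * (b q : ℂ)) p w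
      = (fderiv ℝ a p w : ℂ) + Complex.I * (fderiv ℝ b p w : ℂ) := by
  have h := (Complex.ofRealCLM.hasFDerivAt.comp p ha.hasFDerivAt).add
    ((Complex.ofRealCLM.hasFDerivAt.comp p hb.hasFDerivAt).const_mul Complex.I)
  have h2 := h.fderiv
  simp only [Function.comp_def, Complex.ofRealCLM_apply] at h2
  have h3 := congrArg (fun T => T w) h2
  simpa [Pi.add_def] using h3

theorem fderiv_ofReal {a : E → ℝ} {p : E} (ha : DifferentiableAt ℝ a p) (w : E) :
    fderiv ℝ (fun q => (a q : ℂ)) p w = (fderiv ℝ a p w : ℂ) := by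
  simpa using fderiv_ofReal_add_I_mul ha (differentiableAt_const (0 : ℝ)) w

end Calculus

/-! ### Rotation of the fibres by `i`. -/

/-- Multiplication of the fibre coordinate by `i`. -/
def fibreRot (n : ℕ) : (Cn n × Cn n) ≃L[ℝ] (Cn n × Cn n) :=
  (ContinuousLinearEquiv.refl ℝ (Cn n)).prodCongr
    (ContinuousLinearEquiv.smulLeft (Units.mk0 Complex.I Complex.I_ne_zero))

theorem fibreRot_apply (p : Cn n × Cn n) : fibreRot n p = (p.1, Complex.I • p.2) := rfl

theorem fderiv_fderiv_fibreRot {L : Cn n × Cn n → ℝ} (hL : ∀ p, L (fibreRot n p) = L p)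
    (p : Cn n × Cn n) (u w : Cn n × Cn n) :
    fderiv ℝ (fun q => fderiv ℝ L q (fibreRot n w)) (fibreRot n p) (fibreRot n u)
      = fderiv ℝ (fun q => fderiv ℝ L q w) p u := by
  have h1 : ∀ q w, fderiv ℝ L (fibreRot n q) (fibreRot n w) = fderiv ℝ L q w := fun q w => by
    have := (fibreRot n).comp_right_fderiv (f := L) (x := q)
    rw [show L ∘ fibreRot n = L from funext hL] at this
    rw [this]; rfl
  have h2 := (fibreRot n).comp_right_fderiv (f := fun q => fderiv ℝ L q (fibreRot n w)) (x := p)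
  rw [show (fun q => fderiv ℝ L q (fibreRot n w)) ∘ fibreRot n = fun q => fderiv ℝ L q w from
    funext fun q => h1 q w] at h2
  rw [h2]; rfl

/-- A function with vanishing fibre derivatives takes the same value at `(z, v)` and `(z, iv)`. -/
theorem apply_fibreRot_of_dY_eq_zero {U : Set (Cn n × Cn n)} (hU : IsOpen U)
    (hUc : ∀ p ∈ U, ∀ c : ℂ, c ≠ 0 → (p.1, c • p.2) ∈ U) {f : Cn n × Cn n → ℝ}
    (hf : ContDiffOn ℝ ∞ f U) (h0 : ∀ p ∈ U, ∀ j, dY j f p = 0) {p : Cn n × Cn n} (hp : p ∈ U) :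
    f (fibreRot n p) = f p := by
  have hv : ∀ q ∈ U, ∀ w : Cn n, fderiv ℝ f q (0, w) = 0 := fun q hq w => by
    have hw : ((0 : Cn n), w) = ∑ j, realCoord w j • ((0 : Cn n), (realBasis j : Cn n)) := by
      refine Prod.ext ?_ ?_
      · simp [Prod.fst_sum]
      · rw [Prod.snd_sum]
        exact (sum_realCoord_smul_realBasis w).symm
    rw [hw, map_sum]
    exact Finset.sum_eq_zero fun j _ => by
      rw [map_smul]; exact (congrArg _ (h0 q hq j)).trans (smul_zero _)
  -- The segment from `1` to `i` misses `0`, so `c t • v` joins `v` to `iv` inside the cone, even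
  -- when `n = 1`.
  set c : ℝ → ℂ := fun t => 1 + (t : ℂ) * (Complex.I - 1) with hc
  have hc0 : ∀ t, c t ≠ 0 := fun t h => by
    have h1 := congrArg Complex.re h
    have h2 := congrArg Complex.im h
    simp [hc] at h1 h2
    rw [h2] at h1; simp at h1
  have hcd : ∀ t, HasDerivAt c (Complex.I - 1) t := fun t => by
    simpa [hc] using ((Complex.ofRealCLM.hasDerivAt (x := t)).mul_const (Complex.I - 1)).const_add 1
  have hd : ∀ t, HasDerivAt (fun t => f (p.1, c t • p.2)) 0 t := fun t => by
    have h1 : HasDerivAt (fun t => (p.1, c t • p.2)) ((0 : Cn n), (Complex.I - 1) • p.2) t :=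
      (hasDerivAt_const t p.1).prodMk ((hcd t).smul_const p.2)
    have hq := hUc p hp (c t) (hc0 t)
    have h2 := (differentiableAt_of_contDiffOn hU hf hq).hasFDerivAt.comp_hasDerivAt t h1
    rwa [hv _ hq] at h2
  have := is_const_of_deriv_eq_zero (fun t => (hd t).differentiableAt) (fun t => (hd t).deriv) 1 0
  simpa [hc, fibreRot_apply] using this

/-! ### The Cartan connection form as a matrix, and its complexification. -/

/-- The matrix of the connection form of the Cartan connection along `X`. -/
def cartanMatrix (L : Cn n × Cn n → ℝ) (p X : Cn n × Cn n) : Matrix (RIdx n) (RIdx n) ℝ :=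
  Matrix.of fun k j => cartanForm L j k p X

theorem cartanCov_eq (L : Cn n × Cn n → ℝ) (p X : Cn n × Cn n) (Y : Cn n × Cn n → RIdx n → ℝ) :
    cartanCov L p X Y = (fun k => fderiv ℝ (fun q => Y q k) p X) + cartanMatrix L p X *ᵥ Y p := by
  ext k
  simp [cartanCov, cartanMatrix, Matrix.mulVec, dotProduct, mul_comm]

/-- On sections with constant components the derivative term disappears and only the connection
matrix remains. -/
theorem commute_cartanMatrix_of_const {L : Cn n × Cn n → ℝ} {p X : Cn n × Cn n}
    (h : ∀ Y : RIdx n → ℝ,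
      cartanCov L p X (fun _ => JVert Y) = JVert (cartanCov L p X fun _ => Y)) :
    Commute (cartanMatrix L p X) (Matrix.J (Fin n) ℝ) := by
  rw [commute_iff_eq]
  refine Matrix.ext_of_mulVec_single fun j => ?_
  have := h (Pi.single j 1)
  simp only [cartanCov_eq, JVert_eq_mulVec, fderiv_fun_const, Pi.zero_apply,
    zero_apply] at this
  rw [← Matrix.mulVec_mulVec, ← Matrix.mulVec_mulVec]
  rw [show (fun _ : RIdx n => (0 : ℝ)) = 0 from rfl, zero_add, zero_add] at this
  exact this

theorem cartanCov_JVert {L : Cn n × Cn n → ℝ} {p X : Cn n × Cn n}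
    (h : Commute (cartanMatrix L p X) (Matrix.J (Fin n) ℝ)) (Y : Cn n × Cn n → RIdx n → ℝ) :
    cartanCov L p X (fun q => JVert (Y q)) = JVert (cartanCov L p X Y) := by
  rw [cartanCov_eq, cartanCov_eq]
  have h1 : (fun k => fderiv ℝ (fun q => JVert (Y q) k) p X)
      = JVert (fun k => fderiv ℝ (fun q => Y q k) p X) := by
    ext (k | k) <;> simp [JVert]
  rw [h1, JVert_eq_mulVec (Y p), Matrix.mulVec_mulVec, h.eq, ← Matrix.mulVec_mulVec]
  simp only [JVert_eq_mulVec, Matrix.mulVec_add]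

/-- The complexified Cartan connection in terms of complex components. -/
theorem cartanCovC_apply {L : Cn n × Cn n → ℝ} {p : Cn n × Cn n} (A B : Cn n × Cn n)
    {W : Cn n × Cn n → RIdx n → ℂ} (k : RIdx n) (hW : DifferentiableAt ℝ (fun q => W q k) p) :
    cartanCovC L p A B W k = fderiv ℝ (fun q => W q k) p A + Complex.I * fderiv ℝ (fun q => W q k) p B
      + ∑ j, W p j * (cartanForm L j k p A + Complex.I * cartanForm L j k p B) := by
  have hre : DifferentiableAt ℝ (fun q => (W q k).re) p := Complex.reCLM.differentiableAt.comp p hW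
  have him : DifferentiableAt ℝ (fun q => (W q k).im) p := Complex.imCLM.differentiableAt.comp p hW
  have hd : ∀ X, fderiv ℝ (fun q => W q k) p X
      = (fderiv ℝ (fun q => (W q k).re) p X : ℂ)
        + Complex.I * (fderiv ℝ (fun q => (W q k).im) p X : ℂ) := fun X => by
    rw [← fderiv_ofReal_add_I_mul hre him]
    simp only [mul_comm Complex.I, Complex.re_add_im]
  have hs : ∑ j, W p j * (cartanForm L j k p A + Complex.I * cartanForm L j k p B)
      = ((∑ j, (W p j).re * cartanForm L j k p A : ℝ) : ℂ)
        - ((∑ j, (W p j).im * cartanForm L j k p B : ℝ) : ℂ)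
        + Complex.I * (((∑ j, (W p j).im * cartanForm L j k p A : ℝ) : ℂ)
        + ((∑ j, (W p j).re * cartanForm L j k p B : ℝ) : ℂ)) := by
    push_cast
    rw [← Finset.sum_sub_distrib, ← Finset.sum_add_distrib, Finset.mul_sum,
      ← Finset.sum_add_distrib]
    refine Finset.sum_congr rfl fun j _ => ?_
    conv_lhs => rw [← Complex.re_add_im (W p j)]
    linear_combination ((W p j).im * cartanForm L j k p B : ℂ) * Complex.I_mul_I
  rw [hd, hd, hs]
  simp only [cartanCovC, cartanCov]
  push_cast
  linear_combination (-(fderiv ℝ (fun q => (W q k).im) p B : ℂ)) * Complex.I_mul_I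

theorem cartanForm_vertical (L : Cn n × Cn n → ℝ) (j k l : RIdx n) (p : Cn n × Cn n) :
    cartanForm L j k p (0, realBasis l) = cartanV L k j l p := by
  have h0 : ∀ m, realCoord (0 : Cn n) m = 0 := fun m => by
    rcases m with m | m <;> simp [realCoord]
  simp [cartanForm, deltaYForm, h0, realCoord_realBasis, -Fintype.sum_sum_type]

/-! ### Consequences of `∇𝐉 = 0` in a coordinate domain. -/

/-- A strongly convex complex Finsler metric in a coordinate domain `U`. -/
structure IsLocalMetric (U : Set (Cn n × Cn n)) (L : Cn n × Cn n → ℝ) : Prop where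
  isOpen : IsOpen U
  cone : ∀ p ∈ U, ∀ c : ℂ, c ≠ 0 → (p.1, c • p.2) ∈ U
  smooth : ContDiffOn ℝ ∞ L U
  rot : ∀ p, L (fibreRot n p) = L p
  posDef : ∀ p ∈ U, (fundTensor L p).PosDef

namespace IsLocalMetric

variable {U : Set (Cn n × Cn n)} {L : Cn n × Cn n → ℝ}

theorem smooth_dY (h : IsLocalMetric U L) (j : RIdx n) : ContDiffOn ℝ ∞ (dY j L) U :=
  contDiffOn_fderiv_apply h.isOpen h.smooth _

theorem smooth_dY_dY (h : IsLocalMetric U L) (j k : RIdx n) :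
    ContDiffOn ℝ ∞ (dY j (dY k L)) U :=
  contDiffOn_fderiv_apply h.isOpen (h.smooth_dY k) _

theorem smooth_fundTensor (h : IsLocalMetric U L) (j k : RIdx n) :
    ContDiffOn ℝ ∞ (fun q => fundTensor L q j k) U :=
  contDiffOn_const.mul (h.smooth_dY_dY j k)

theorem isUnit_det (h : IsLocalMetric U L) {p : Cn n × Cn n} (hp : p ∈ U) :
    IsUnit (fundTensor L p).det :=
  (Matrix.isUnit_iff_isUnit_det _).1 (h.posDef p hp).isUnit

theorem dY_comm (h : IsLocalMetric U L) {p : Cn n × Cn n} (hp : p ∈ U) (j k : RIdx n) :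
    dY j (dY k L) p = dY k (dY j L) p :=
  fderiv_fderiv_apply_comm h.isOpen h.smooth hp _ _

theorem fundTensor_symm (h : IsLocalMetric U L) {p : Cn n × Cn n} (hp : p ∈ U) (j k : RIdx n) :
    fundTensor L p j k = fundTensor L p k j := by
  simp only [fundTensor, Matrix.of_apply, h.dY_comm hp]

/-- If the vertical Cartan coefficients are complex linear, the metric is quadratic along the
fibres. -/
theorem dY_dY_dY_eq_zero (h : IsLocalMetric U L) {p : Cn n × Cn n} (hp : p ∈ U)
    (hJ : ∀ X, Commute (cartanMatrix L p X) (Matrix.J (Fin n) ℝ)) (j l s : RIdx n) :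
    dY j (dY l (dY s L)) p = 0 := by
  have c₁ : ∀ j l s, dY j (dY l (dY s L)) p = dY l (dY j (dY s L)) p := fun j l s =>
    fderiv_fderiv_apply_comm h.isOpen (h.smooth_dY s) hp _ _
  have c₂ : ∀ j l s, dY j (dY l (dY s L)) p = dY j (dY s (dY l L)) p := fun j l s =>
    DFunLike.congr_fun
      (fderiv_apply_congr h.isOpen (fun q hq => h.dY_comm hq l s) hp) (0, realBasis j)
  have key := symmetric_tensor_eq_zero (h.posDef p hp)
    (T := fun l => Matrix.of fun s j => 1 / 4 * dY j (dY l (dY s L)) p)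
    (fun l s j => by
      simp only [Matrix.of_apply]; rw [c₁, c₂ l j s, c₁])
    (fun l s j => by simp only [Matrix.of_apply]; rw [c₂])
    (fun l => by
      -- The vector `∂/∂y^l` has no `dx`-part, so it isolates the vertical coefficients.
      convert hJ (0, realBasis l) using 1
      ext k j
      rw [cartanMatrix, Matrix.of_apply, cartanForm_vertical, cartanV, Matrix.mul_apply,
        Finset.mul_sum]
      exact Finset.sum_congr rfl fun s _ => by rw [Matrix.of_apply]; ring)
  have := congrFun (congrFun (key l) s) j
  simpa using this

theorem dY_fundTensor_eq (h : IsLocalMetric U L) {p : Cn n × Cn n} (hp : p ∈ U) (i j k : RIdx n) :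
    dY i (fun q => fundTensor L q j k) p = 1 / 2 * dY i (dY j (dY k L)) p := by
  have := fderiv_const_mul (differentiableAt_of_contDiffOn h.isOpen (h.smooth_dY_dY j k) hp) (1 / 2 : ℝ)
  exact congrArg (fun T => T (0, realBasis i)) this

/-- The fibre Hessian at `iv` on rotated vectors equals the one at `v`; being constant along a path
from `v` to `iv`, it is itself invariant under rotation. -/
theorem jInvariant_fundTensor (h : IsLocalMetric U L)
    (h0 : ∀ p ∈ U, ∀ j l s, dY j (dY l (dY s L)) p = 0) {p : Cn n × Cn n} (hp : p ∈ U) :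
    JInvariant (fundTensor L p) := by
  have hc : ∀ j k, dY j (dY k L) (fibreRot n p) = dY j (dY k L) p := fun j k =>
    apply_fibreRot_of_dY_eq_zero h.isOpen h.cone (h.smooth_dY_dY j k)
      (fun q hq i => h0 q hq i j k) hp
  have hr := fun j k : RIdx n =>
    fderiv_fderiv_fibreRot h.rot p (0, realBasis j) (0, realBasis k)
  simp only [fibreRot_apply (_, _)] at hr
  intro α β
  have h1 := hr (Sum.inl α) (Sum.inl β)
  have h2 := hr (Sum.inr α) (Sum.inl β)
  simp only [I_smul_realBasis_inl, I_smul_realBasis_inr] at h1 h2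
  have h1' : dY (Sum.inr α) (dY (Sum.inr β) L) (fibreRot n p)
    = dY (Sum.inl α) (dY (Sum.inl β) L) p := h1
  have hneg : ((0 : Cn n), -(realBasis (Sum.inl α) : Cn n)) = -(0, realBasis (Sum.inl α)) := by
    simp
  rw [hneg, map_neg] at h2
  have h2' : -dY (Sum.inl α) (dY (Sum.inr β) L) (fibreRot n p)
    = dY (Sum.inr α) (dY (Sum.inl β) L) p := h2
  rw [hc] at h1' h2'
  simp only [fundTensor, Matrix.of_apply]
  constructor
  · rw [h1']
  · rw [← h2']; ring

theorem levi_eq_hermOf (h : IsLocalMetric U L)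
    (h0 : ∀ p ∈ U, ∀ j l s, dY j (dY l (dY s L)) p = 0) {p : Cn n × Cn n} (hp : p ∈ U) :
    levi L p = hermOf (fundTensor L p) := by
  ext α τ
  have hd : ∀ q ∈ U, dVbar τ (fun q => (L q : ℂ)) q
      = ((1 / 2 * dY (Sum.inl τ) L q : ℝ) : ℂ)
        + Complex.I * ((1 / 2 * dY (Sum.inr τ) L q : ℝ) : ℂ) := fun q hq => by
    have hL := differentiableAt_of_contDiffOn h.isOpen h.smooth hq
    simp only [dVbar, dY, fderiv_ofReal hL]
    push_cast; ring
  have hdiff := fun j => (differentiableAt_of_contDiffOn h.isOpen (h.smooth_dY j) hp)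
  have h2 : ∀ j, dY j (dVbar τ (fun q => (L q : ℂ))) p
      = (fundTensor L p j (Sum.inl τ) : ℂ) + Complex.I * (fundTensor L p j (Sum.inr τ) : ℂ) := by
    intro j
    rw [dY, fderiv_apply_congr h.isOpen hd hp, fderiv_ofReal_add_I_mul
      ((hdiff _).const_mul _) ((hdiff _).const_mul _), fderiv_const_mul (hdiff _),
      fderiv_const_mul (hdiff _)]
    simp [fundTensor, dY]
  have hJ := h.jInvariant_fundTensor h0 hp α τ
  simp only [levi, Matrix.of_apply, dV, h2, hermOf]
  rw [hJ.1, show fundTensor L p (Sum.inr α) (Sum.inl τ) = - fundTensor L p (Sum.inl α) (Sum.inr τ) by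
    linarith [hJ.2]]
  push_cast
  linear_combination (-(fundTensor L p (Sum.inl α) (Sum.inl τ) : ℂ) / 2) * Complex.I_mul_I

theorem fderiv_levi (h : IsLocalMetric U L)
    (h0 : ∀ p ∈ U, ∀ j l s, dY j (dY l (dY s L)) p = 0) {p : Cn n × Cn n} (hp : p ∈ U)
    (α τ : Fin n) (w : Cn n × Cn n) :
    fderiv ℝ (fun q => levi L q α τ) p w
      = hermOf (Matrix.of fun j k => fderiv ℝ (fun q => fundTensor L q j k) p w) α τ := by
  have hd := fun j k => differentiableAt_of_contDiffOn h.isOpen (h.smooth_fundTensor j k) hp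
  rw [fderiv_apply_congr h.isOpen (g := fun q => hermOf (fundTensor L q) α τ)
    (fun q hq => by rw [h.levi_eq_hermOf h0 hq]) hp]
  simp only [hermOf, Matrix.of_apply]
  rw [fderiv_ofReal_add_I_mul (hd _ _) (hd _ _)]

theorem dV_levi (h : IsLocalMetric U L)
    (h0 : ∀ p ∈ U, ∀ j l s, dY j (dY l (dY s L)) p = 0) {p : Cn n × Cn n} (hp : p ∈ U)
    (γ α τ : Fin n) : dV γ (fun q => levi L q α τ) p = 0 := by
  have hz : ∀ i j k, fderiv ℝ (fun q => fundTensor L q j k) p (0, realBasis i) = 0 := fun i j k => by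
    have := h.dY_fundTensor_eq hp i j k
    rwa [h0 p hp, mul_zero] at this
  simp [dV, dY, h.fderiv_levi h0 hp, hermOf, hz]

theorem chernV_eq_zero (h : IsLocalMetric U L)
    (h0 : ∀ p ∈ U, ∀ j l s, dY j (dY l (dY s L)) p = 0) {p : Cn n × Cn n} (hp : p ∈ U)
    (α β γ : Fin n) : chernV L α β γ p = 0 := by
  simp [chernV, h.dV_levi h0 hp]

theorem cartanV_eq_zero {p : Cn n × Cn n} (h0 : ∀ j l s, dY j (dY l (dY s L)) p = 0)
    (k j l : RIdx n) : cartanV L k j l p = 0 := by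
  simp only [cartanV, h0, mul_zero, Finset.sum_const_zero]

theorem cartanForm_eq {p : Cn n × Cn n} (h0 : ∀ j l s, dY j (dY l (dY s L)) p = 0)
    (j k : RIdx n) (X : Cn n × Cn n) :
    cartanForm L j k p X = ∑ l, cartanH L k j l p * realCoord X.1 l := by
  simp only [cartanForm, cartanV_eq_zero h0, zero_mul, add_zero]

/-- With the vertical coefficients gone, `∂/∂x^l` isolates the horizontal ones, although it need not
be a horizontal vector. -/
theorem commute_cartanH {p : Cn n × Cn n} (h0 : ∀ j l s, dY j (dY l (dY s L)) p = 0)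
    (hJ : ∀ X, Commute (cartanMatrix L p X) (Matrix.J (Fin n) ℝ)) (l : RIdx n) :
    Commute (Matrix.of fun k j => cartanH L k j l p) (Matrix.J (Fin n) ℝ) := by
  convert hJ (realBasis l, 0) using 1
  ext k j
  simp [cartanMatrix, cartanForm_eq h0, realCoord_realBasis, -Fintype.sum_sum_type]

/-- For a `J`-parallel Cartan connection, the complex horizontal Cartan coefficients are those of the
Chern–Finsler connection. -/
theorem complexCartanH_eq_chernH (h : IsLocalMetric U L)
    (h0 : ∀ p ∈ U, ∀ j l s, dY j (dY l (dY s L)) p = 0) {p : Cn n × Cn n} (hp : p ∈ U)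
    (hJ : ∀ X, Commute (cartanMatrix L p X) (Matrix.J (Fin n) ℝ)) (α β γ : Fin n) :
    complexCartanH L β α γ p = chernH L β α γ p := by
  set dg : RIdx n → Matrix (RIdx n) (RIdx n) ℝ :=
    fun l => Matrix.of fun j k => fderiv ℝ (fun q => fundTensor L q j k) p (realBasis l, 0) with hdg
  have hδ : ∀ l j k, deltaX L l (fun q => fundTensor L q j k) p = dg l j k := fun l j k => by
    simp only [deltaX, h.dY_fundTensor_eq hp, h0 p hp, mul_zero, Finset.sum_const_zero, sub_zero]
    rfl
  have hsymm : ∀ l j k, dg l j k = dg l k j := fun l j k =>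
    DFunLike.congr_fun
      (fderiv_apply_congr h.isOpen (fun q hq => h.fundTensor_symm hq j k) hp) (realBasis l, 0)
  have hinv := h.jInvariant_fundTensor h0 hp
  have key := sum_levi_civita_mul_hermOf (h.fundTensor_symm hp) (h.isUnit_det hp) hinv hsymm
    (Γ := fun k j l => cartanH L k j l p) (fun k j l => by simp only [cartanH, hδ])
    (commute_cartanH (h0 p hp) hJ) α γ
  have hG := isUnit_det_hermOf hinv (h.isUnit_det hp)
  have hdz : ∀ τ, deltaZ L γ (fun q => levi L q α τ) p
      = ((fun β => complexCartanH L β α γ p) ᵥ* hermOf (fundTensor L p)) τ := fun τ => by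
    rw [deltaZ, dZ, dX, dX, h.fderiv_levi h0 hp, h.fderiv_levi h0 hp]
    simp only [h.dV_levi h0 hp, mul_zero, Finset.sum_const_zero, sub_zero]
    exact (key τ).symm
  -- The lowered identity `key` is solved for the coefficients by inverting the Hermitian matrix.
  have hN : ((fun β => complexCartanH L β α γ p) ᵥ* hermOf (fundTensor L p)) ᵥ*
      (hermOf (fundTensor L p))⁻¹ = fun β => complexCartanH L β α γ p := by
    rw [Matrix.vecMul_vecMul, Matrix.mul_nonsing_inv _ hG, Matrix.vecMul_one]
  rw [chernH, h.levi_eq_hermOf h0 hp]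
  simp only [hdz]
  refine (congrFun hN β).symm.trans ?_
  simp only [Matrix.vecMul, dotProduct]
  exact Finset.sum_congr rfl fun τ _ => mul_comm _ _

/-- For a `J`-parallel Cartan connection, the complexified connection form is the Chern–Finsler
connection form. -/
theorem cartanForm_add_eq_chernForm (h : IsLocalMetric U L)
    (h0 : ∀ p ∈ U, ∀ j l s, dY j (dY l (dY s L)) p = 0) {p : Cn n × Cn n} (hp : p ∈ U)
    (hJ : ∀ X, Commute (cartanMatrix L p X) (Matrix.J (Fin n) ℝ)) (β α : Fin n)
    (A B : Cn n × Cn n) :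
    ((cartanForm L (Sum.inl β) (Sum.inl α) p A : ℂ)
        + Complex.I * cartanForm L (Sum.inl β) (Sum.inr α) p A)
      + Complex.I * (cartanForm L (Sum.inl β) (Sum.inl α) p B
        + Complex.I * cartanForm L (Sum.inl β) (Sum.inr α) p B)
      = chernForm L β α p A B := by
  -- Symmetry in the lower indices carries complex linearity from the section slot to the `dx^l`
  -- slot, so the `(1,0)`-part of the form involves only `dz^μ`.
  have hsymm : ∀ k j l, cartanH L k j l p = cartanH L k l j p := fun k j l => by
    simp only [cartanH]
    refine Finset.sum_congr rfl fun s _ => ?_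
    have e : ∀ i a b, deltaX L i (fun q => fundTensor L q a b) p
        = deltaX L i (fun q => fundTensor L q b a) p := fun i a b => by
      have := fderiv_apply_congr h.isOpen (fun q hq => h.fundTensor_symm hq a b) hp
      simp only [deltaX, dX, dY, this]
    rw [e l s j, e j l s, e s j l]; ring
  have hone : ∀ X : Cn n × Cn n, (cartanForm L (Sum.inl β) (Sum.inl α) p X : ℂ)
        + Complex.I * cartanForm L (Sum.inl β) (Sum.inr α) p X
      = ∑ μ, chernH L α β μ p * X.1 μ := fun X => by
    rw [cartanForm_eq (h0 p hp), cartanForm_eq (h0 p hp), Fintype.sum_sum_type,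
      Fintype.sum_sum_type, ← Finset.sum_add_distrib, ← Finset.sum_add_distrib]
    push_cast
    rw [Finset.mul_sum, ← Finset.sum_add_distrib]
    refine Finset.sum_congr rfl fun μ _ => ?_
    have hc := (commute_J_iff _).1 (commute_cartanH (h0 p hp) hJ (Sum.inl β)) μ α
    simp only [Matrix.of_apply] at hc
    rw [← h.complexCartanH_eq_chernH h0 hp hJ, complexCartanH,
      hsymm (Sum.inl α) _ (Sum.inr μ), hsymm (Sum.inr α) _ (Sum.inr μ), hc.1, hc.2,
      hsymm (Sum.inr α) (Sum.inl μ), hsymm (Sum.inl α) (Sum.inl μ)]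
    conv_rhs => rw [← Complex.re_add_im (X.1 μ)]
    simp only [realCoord, Sum.elim_inl, Sum.elim_inr]
    push_cast
    linear_combination (-(cartanH L (Sum.inr α) (Sum.inl β) (Sum.inl μ) p : ℂ) * (X.1 μ).im)
      * Complex.I_mul_I
  rw [hone, hone, chernForm]
  simp only [h.chernV_eq_zero h0 hp, zero_mul, add_zero, dzForm, mul_add, Finset.mul_sum,
    Finset.sum_add_distrib]
  congr 1
  exact Finset.sum_congr rfl fun μ _ => by ring

/-- For a `J`-parallel Cartan connection, the complexified Cartan connection is the Chern–Finsler
connection. -/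
theorem cartanCovC_vertIncl (h : IsLocalMetric U L)
    (h0 : ∀ p ∈ U, ∀ j l s, dY j (dY l (dY s L)) p = 0) {p : Cn n × Cn n} (hp : p ∈ U)
    (hJ : ∀ X, Commute (cartanMatrix L p X) (Matrix.J (Fin n) ℝ)) (A B : Cn n × Cn n)
    {V : Cn n × Cn n → Cn n} (hV : DifferentiableAt ℝ V p) :
    cartanCovC L p A B (fun q => vertIncl (V q)) = vertIncl (chernCov L p A B V) := by
  have hVα : ∀ α, DifferentiableAt ℝ (fun q => V q α) p := fun α => differentiableAt_pi.1 hV α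
  have hc := fun (X : Cn n × Cn n) (b a : Fin n) => (commute_J_iff _).1 (hJ X) b a
  simp only [cartanMatrix, Matrix.of_apply] at hc
  ext (α | α)
  · rw [cartanCovC_apply A B _ ((hVα α).const_mul (1 / 2 : ℂ))]
    simp only [vertIncl, Sum.elim_inl, Sum.elim_inr, chernCov, Fintype.sum_sum_type]
    rw [fderiv_const_mul (hVα α), ← Finset.sum_add_distrib, mul_add, Finset.mul_sum]
    simp only [smul_apply, smul_eq_mul]
    congr 1
    · ring
    refine Finset.sum_congr rfl fun β _ => ?_
    rw [← h.cartanForm_add_eq_chernForm h0 hp hJ, (hc A β α).2, (hc B β α).2]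
    push_cast
    ring
  · have hd : DifferentiableAt ℝ (fun q => vertIncl (V q) (Sum.inr α)) p :=
      ((hVα α).const_mul (1 / 2 * Complex.I)).neg
    rw [cartanCovC_apply A B _ hd]
    simp only [vertIncl, Sum.elim_inl, Sum.elim_inr, chernCov, Fintype.sum_sum_type]
    rw [fderiv_fun_neg, fderiv_const_mul (hVα α), ← Finset.sum_add_distrib, mul_add, neg_add,
      Finset.mul_sum, ← Finset.sum_neg_distrib]
    simp only [smul_apply, neg_apply, smul_eq_mul]
    congr 1
    · ring
    refine Finset.sum_congr rfl fun β _ => ?_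
    rw [← h.cartanForm_add_eq_chernForm h0 hp hJ, (hc A β α).1, (hc B β α).1]
    linear_combination (V p β / 2) * (cartanForm L (Sum.inl β) (Sum.inr α) p A
      + Complex.I * cartanForm L (Sum.inl β) (Sum.inr α) p B) * Complex.I_mul_I

end IsLocalMetric

/-! ### The converse, and the passage from charts to the manifold. -/

/-- If the complexified Cartan connection preserves the holomorphic vertical bundle, its connection
form commutes with `J`. -/
theorem commute_cartanMatrix_of_eq_vertIncl {L : Cn n × Cn n → ℝ} {p X : Cn n × Cn n}
    (h : ∀ V : Cn n, ∃ V' : Cn n, cartanCovC L p X 0 (fun _ => vertIncl V) = vertIncl V') :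
    Commute (cartanMatrix L p X) (Matrix.J (Fin n) ℝ) := by
  refine (commute_J_iff _).2 fun α β => ?_
  obtain ⟨V', hV'⟩ := h (Pi.single α 1)
  have h1 := congrFun hV' (Sum.inl β)
  have h2 := congrFun hV' (Sum.inr β)
  rw [cartanCovC_apply _ _ _ (differentiableAt_const _)] at h1 h2
  have hz : ∀ j k, cartanForm L j k p 0 = 0 := fun j k => by
    have h0 : ∀ m, realCoord (0 : Cn n) m = 0 := fun m => by
      rcases m with m | m <;> simp [realCoord]
    simp [cartanForm, deltaYForm, h0, -Fintype.sum_sum_type]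
  simp only [hz, vertIncl, Fintype.sum_sum_type, Sum.elim_inl, Sum.elim_inr, Pi.single_apply] at h1 h2
  simp at h1 h2
  -- Membership in the holomorphic bundle means `W^{β*} = -i W^β`. Eliminating `V'` leaves this
  -- relation, whose real and imaginary parts are the Cauchy–Riemann relations.
  have h3 : (cartanForm L (Sum.inl α) (Sum.inr β) p X : ℂ)
      - Complex.I * cartanForm L (Sum.inr α) (Sum.inr β) p X
      = -(cartanForm L (Sum.inr α) (Sum.inl β) p X : ℂ)
        - Complex.I * cartanForm L (Sum.inl α) (Sum.inl β) p X := by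
    linear_combination 2 * h2 + 2 * Complex.I * h1
      + (cartanForm L (Sum.inr α) (Sum.inl β) p X : ℂ) * Complex.I_mul_I
  have hre := congrArg Complex.re h3
  have him := congrArg Complex.im h3
  simp at hre him
  simp only [cartanMatrix, Matrix.of_apply]
  exact ⟨him, by linarith⟩

theorem isOpen_slit {M : Type*} [TopologicalSpace M] [ChartedSpace (Cn n) M]
    (e : OpenPartialHomeomorph M (Cn n)) : IsOpen (slit e) :=
  (e.open_target.preimage continuous_fst).inter
    ((isOpen_compl_singleton (x := (0 : Cn n))).preimage continuous_snd)

theorem IsStronglyConvex.isLocalMetric {M : Type*} [TopologicalSpace M] [ChartedSpace (Cn n) M]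
    {F : TangentBundle 𝓘(ℂ, Cn n) M → ℝ} (hF : IsStronglyConvex F)
    {e : OpenPartialHomeomorph M (Cn n)} (he : e ∈ holCharts n M) :
    IsLocalMetric (slit e) (localSq F e) where
  isOpen := isOpen_slit e
  cone := fun _ hp _ hc => ⟨hp.1, smul_ne_zero hc hp.2⟩
  smooth := (hF.smooth e he).pow 2
  rot := fun p => by
    -- The tangent map of `e.symm` is complex linear, so the coordinate rotation is multiplication
    -- by `i` on tangent vectors, and `‖i‖ = 1`.
    have : chartVector e (fibreRot n p) = ⟨e.symm p.1, Complex.I •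
        (mfderiv 𝓘(ℂ, Cn n) 𝓘(ℂ, Cn n) e.symm p.1 p.2 : TangentSpace 𝓘(ℂ, Cn n) (e.symm p.1))⟩ := by
      exact congrArg _ ((mfderiv 𝓘(ℂ, Cn n) 𝓘(ℂ, Cn n) e.symm p.1).map_smul Complex.I p.2)
    rw [localSq, this, hF.homogeneous]
    simp [localSq, chartVector]
  posDef := hF.posDef e he

end ComplexFinsler

end

theorem theorem1p1 {n : ℕ} {M : Type*} [TopologicalSpace M] [ChartedSpace (ComplexFinsler.Cn n) M]
    [IsManifold 𝓘(ℂ, ComplexFinsler.Cn n) ω M]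
    (F : TangentBundle 𝓘(ℂ, ComplexFinsler.Cn n) M → ℝ) (hF : ComplexFinsler.IsStronglyConvex F) :
    (ComplexFinsler.CartanJParallel F ↔ ComplexFinsler.CartanEqChernFinsler F) ∧
    (ComplexFinsler.CartanJParallel F →
      ∀ e ∈ ComplexFinsler.holCharts n M, ∀ p ∈ ComplexFinsler.slit e, ∀ α β γ : Fin n,
        ComplexFinsler.complexCartanH (ComplexFinsler.localSq F e) β α γ p
            = ComplexFinsler.chernH (ComplexFinsler.localSq F e) β α γ p ∧
        ComplexFinsler.complexCartanV (ComplexFinsler.localSq F e) β α γ p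
            = ComplexFinsler.chernV (ComplexFinsler.localSq F e) β α γ p) := by
  open ComplexFinsler in
  have hcomm : CartanJParallel F → ∀ e ∈ holCharts n M, ∀ p ∈ slit e, ∀ X,
      Commute (cartanMatrix (localSq F e) p X) (Matrix.J (Fin n) ℝ) := fun hJ e he p hp X =>
    commute_cartanMatrix_of_const fun Y => hJ e he p hp X (fun _ => Y) contDiffOn_const
  have hzero : CartanJParallel F → ∀ e ∈ holCharts n M, ∀ p ∈ slit e, ∀ j l s,
      dY j (dY l (dY s (localSq F e))) p = 0 := fun hJ e he p hp =>
    (hF.isLocalMetric he).dY_dY_dY_eq_zero hp (hcomm hJ e he p hp)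
  refine ⟨⟨fun hJ e he p hp A B V hV => ?_, fun h e he p hp X Y _ => ?_⟩,
    fun hJ e he p hp α β γ => ⟨?_, ?_⟩⟩
  · exact (hF.isLocalMetric he).cartanCovC_vertIncl (hzero hJ e he) hp (hcomm hJ e he p hp) A B
      (differentiableAt_of_contDiffOn (isOpen_slit e) hV hp)
  · exact cartanCov_JVert (commute_cartanMatrix_of_eq_vertIncl fun V =>
      ⟨_, h e he p hp X 0 (fun _ => V) contDiffOn_const⟩) Y
  · exact (hF.isLocalMetric he).complexCartanH_eq_chernH (hzero hJ e he) hp (hcomm hJ e he p hp)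
      α β γ
  · rw [(hF.isLocalMetric he).chernV_eq_zero (hzero hJ e he) hp]
    simp [complexCartanV, IsLocalMetric.cartanV_eq_zero (hzero hJ e he p hp)]
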